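/- Let $\theta_3(\tau)=\sum_{n\in\mathbb Z}e^{\pi i n^2\tau}$ and $\theta_2(\tau)=\sum_{n\in\mathbb Z}e^{\pi i (n-1/2)^2\tau}$ for $\operatorname{Im}\tau>0$. For every $\gamma=\begin{pmatrix}a&b\\c&d\end{pmatrix}\in SL_2(\mathbb Z)$ with $a$ and $c$ odd there is exactly one constant $\kappa(\gamma)\in\mathbb C$ (the $\theta_3$-multiplier) such that $$\theta_3\!\left(\frac{a\tau+b}{c\tau+d}\right)=\kappa(\gamma)\,e^{-\pi i/4}(c\tau+d)^{1/2}\,\theta_2(\tau)\qquad(\operatorname{Im}\tau>0),$$ where the square root is the principal one. Let $l\ge 1$ be odd, $k=2l$, and let $m$ be an integer. For every $h$ prime to $k$ choose any integer $h'$ with $hh'\equiv-1 \pmod k$, put $$\gamma=\gamma_h=\begin{pmatrix}h'&-\frac{hh'+1}{l}\\ l&-h\end{pmatrix},$$ and define $$A_k(m)=-i\sum_{\substack{0\le h<k\\(h,k)=1}}\kappa(\gamma_h^{-1})\,e^{-2\pi i\frac{4mh+3h'}{4k}} .$$ Then, for every such choice of the $h'$, $$A_k(m)=i^{\frac{(l+3)(l-1)}{4}}\,(-1)^{m-1}\,S(m,-3B_l^4,l),\qquad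 B_l=\frac{l+1}{2},$$ where $S$ is the Salié sum $$S(a,b,l)=\sum_{\substack{h \bmod l\\(h,l)=1}}\left(\frac{h}{l}\right)e^{\frac{2\pi i}{l}(ah+b\bar h)},\qquad h\bar h\equiv1\pmod l,$$ with $\left(\frac{h}{l}\right)$ the Jacobi symbol. -/

import Mathlib

open scoped UpperHalfPlane MatrixGroups

/-- The theta constant `θ₂(τ) = ∑ q^{(n - 1/2)²}` with `q = e^{πiτ}`. -/
noncomputable def theta2 (τ : ℂ) : ℂ :=
  ∑' n : ℤ, Complex.exp (Real.pi * Complex.I * ((n : ℂ) - 1 / 2) ^ 2 * τ)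

/-- The theta constant `θ₃(τ) = ∑ q^{n²}` with `q = e^{πiτ}`. -/
noncomputable def theta3 (τ : ℂ) : ℂ :=
  ∑' n : ℤ, Complex.exp (Real.pi * Complex.I * (n : ℂ) ^ 2 * τ)

/-- For `γ = (a, b; c, d)` carrying `∞` to a rational `a / c` with `a`, `c` odd, `κ` is the
multiplier of `θ₃` at `γ`:
`θ₃(γ τ) = κ · e^{-πi/4} (cτ + d)^{1/2} · θ₂(τ)` on the whole upper half plane, with the principal
branch of the square root. -/
def IsTheta3Multiplier (γ : SL(2, ℤ)) (κ : ℂ) : Prop :=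
  ∀ τ : ℍ, theta3 ((γ • τ : ℍ) : ℂ) =
    κ * (Complex.exp (-(Real.pi * Complex.I / 4)) *
      (((γ 1 0 : ℤ) : ℂ) * (τ : ℂ) + ((γ 1 1 : ℤ) : ℂ)) ^ (1 / 2 : ℂ)) * theta2 τ

open Classical in
/-- The multiplier `κ(γ)` of `θ₃` (the value `0` when there is none never occurs
for `γ` with odd first column). -/
noncomputable def theta3Multiplier (γ : SL(2, ℤ)) : ℂ :=
  if H : ∃ κ : ℂ, IsTheta3Multiplier γ κ then H.choose else 0

/-- The matrix `γ = (h', -(hh' + 1) / l; l, -h)`, where `l ∣ hh' + 1`.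
It carries the cusp `h / l` to `∞`. -/
def cuspMatrix (l h h' : ℤ) (H : l ∣ h * h' + 1) : SL(2, ℤ) :=
  ⟨!![h', -((h * h' + 1) / l); l, -h], by
    rw [Matrix.det_fin_two_of, neg_mul, Int.ediv_mul_cancel H]
    ring⟩

/-- A choice of `h'` with `h h' ≡ -1 (mod k)` for every `h` prime to `k`. -/
def IsNegInverseChoice (k : ℕ) (h' : ℕ → ℤ) : Prop :=
  ∀ h : ℕ, h.Coprime k → (k : ℤ) ∣ (h : ℤ) * h' h + 1

theorem IsNegInverseChoice.dvd {l : ℕ} {h' : ℕ → ℤ} (hh' : IsNegInverseChoice (2 * l) h')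
    {h : ℕ} (hh : h ∈ (Finset.range (2 * l)).filter (fun h => h.Coprime (2 * l))) :
    (l : ℤ) ∣ (h : ℤ) * h' h + 1 :=
  dvd_trans ⟨2, by push_cast; ring⟩ (hh' h (Finset.mem_filter.mp hh).2)

/-- The arithmetic factor `A_k(m)` for `k = 2l`:
`A_k(m) = -i ∑_{0 ≤ h < k, (h, k) = 1} κ(γ⁻¹) e^{-2πi (4mh + 3h') / (4k)}`,
where `γ = (h', -(hh' + 1) / l; l, -h)`. -/
noncomputable def arithmeticFactor (l : ℕ) (h' : ℕ → ℤ) (hh' : IsNegInverseChoice (2 * l) h')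
    (m : ℤ) : ℂ :=
  -Complex.I *
    ∑ h ∈ ((Finset.range (2 * l)).filter (fun h => h.Coprime (2 * l))).attach,
      theta3Multiplier (cuspMatrix l (h : ℕ) (h' h) (hh'.dvd h.2))⁻¹ *
        Complex.exp (-(2 * Real.pi * Complex.I *
          ((4 * (m : ℂ) * ((h : ℕ) : ℂ) + 3 * (h' h : ℂ)) / (4 * ((2 * l : ℕ) : ℂ)))))

/-- The Salié sum `S(a, b, l) = ∑_{h mod l, (h, l) = 1} (h / l) e^{(2πi / l) (a h + b h̄)}`,
with the Jacobi symbol `(h / l)` and `h h̄ ≡ 1 (mod l)`. -/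
noncomputable def salieSum (a b : ℤ) (l : ℕ) : ℂ :=
  ∑ h ∈ (Finset.range l).filter (fun h => h.Coprime l),
    (jacobiSym (h : ℤ) l : ℂ) *
      Complex.exp (2 * Real.pi * Complex.I / (l : ℂ) *
        ((a : ℂ) * (h : ℂ) + (b : ℂ) * ((((h : ZMod l)⁻¹).val : ℕ) : ℂ)))

/-! Everything rests on the behaviour of `θ₃` at a cusp `h / l` with `h`, `l` odd
(`theta3_at_cusp`). Split the series by residues `r` mod `l` and apply the Jacobi inversion formula
to each class. The parity of `h` and `l` shifts the dual summation to `n - 1/2`, so `θ₂` appears.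
The `r`-dependence becomes a finite quadratic sum, which completing the square turns into a Gauss
sum times a factor that merges into the argument of `θ₂`.

The Gauss sum comes from the same formula. Comparing two transformations of `θ₃` at one point gives
`G(l; 2)` (`quadGaussSum_two`). The CRT relation `G(l; ca) G(a; cl) = G(la; c)` and quadratic
reciprocity then give `G(l; 2a)` by induction on `l` (`quadGaussSum_eval`).

This makes the multiplier explicit (`isTheta3Multiplier_of_neg`): a Jacobi symbol, a factor `ε_l`
and a root of unity. Uniqueness holds because `θ₂(i) ≠ 0`. Under `H ≡ -B h (mod l)`, with `B` the
inverse of 2, the odd `h` mod `2l` prime to `l` correspond to the units `H` mod `l`, and `A_k(m)`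
agrees with the Salié sum term by term (`arithmeticFactor_term_eq`). -/

/-! ### Quadratic Gauss sums: multiplicativity and completing the square. -/

/-- The quadratic Gauss sum `∑_{x mod l} e^{2πi c x² / l}`. -/
noncomputable def quadGaussSum (l : ℕ) [NeZero l] (c : ZMod l) : ℂ :=
  ∑ x : ZMod l, ZMod.stdAddChar (c * x ^ 2)

theorem quadGaussSum_one (c : ZMod 1) : quadGaussSum 1 c = 1 := by
  have hc : ∀ y : ZMod 1, y = 0 := fun y => Subsingleton.elim _ _
  rw [quadGaussSum, Fintype.sum_subsingleton _ (0 : ZMod 1), hc (c * 0 ^ 2),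
    AddChar.map_zero_eq_one]

theorem quadGaussSum_neg (l : ℕ) [NeZero l] (c : ZMod l) :
    quadGaussSum l (-c) = (starRingEnd ℂ) (quadGaussSum l c) := by
  simp only [quadGaussSum, map_sum, neg_mul, AddChar.map_neg_eq_conj]

theorem stdAddChar_natCast_mul (l a : ℕ) [NeZero l] [NeZero a] [NeZero (l * a)] (r : ℤ) :
    (ZMod.stdAddChar ((a * r : ℤ) : ZMod (l * a)) : ℂ) = ZMod.stdAddChar ((r : ℤ) : ZMod l) := by
  have hl : (l : ℂ) ≠ 0 := by exact_mod_cast NeZero.ne l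
  have ha : (a : ℂ) ≠ 0 := by exact_mod_cast NeZero.ne a
  rw [ZMod.stdAddChar_coe, ZMod.stdAddChar_coe]
  congr 1
  push_cast
  field_simp

theorem bijective_crt_combination {l a : ℕ} [NeZero l] [NeZero a] [NeZero (l * a)]
    (h : l.Coprime a) :
    Function.Bijective (fun p : ZMod l × ZMod a =>
      ((a * (p.1.val : ℤ) + l * (p.2.val : ℤ) : ℤ) : ZMod (l * a))) := by
  rw [Fintype.bijective_iff_injective_and_card]
  refine ⟨?_, by simp [ZMod.card]⟩
  rintro ⟨r, s⟩ ⟨r', s'⟩ hp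
  have ha : IsUnit (a : ZMod l) := (ZMod.isUnit_iff_coprime a l).mpr h.symm
  have hl : IsUnit (l : ZMod a) := (ZMod.isUnit_iff_coprime l a).mpr h
  have h1 := congrArg (ZMod.castHom (dvd_mul_right l a) (ZMod l)) hp
  have h2 := congrArg (ZMod.castHom (dvd_mul_left a l) (ZMod a)) hp
  simp only [map_intCast] at h1 h2
  push_cast at h1 h2
  simp only [ZMod.natCast_self, zero_mul, add_zero, zero_add, ZMod.natCast_zmod_val] at h1 h2
  rw [ha.mul_left_cancel h1, hl.mul_left_cancel h2]

/-- Write `x = a r + l s` by the Chinese remainder theorem. The cross term of `x²` is a multiple of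
`l a`, so the character splits into a factor in `r` mod `l` and one in `s` mod `a`. -/
theorem quadGaussSum_mul_quadGaussSum {l a : ℕ} [NeZero l] [NeZero a] [NeZero (l * a)]
    (h : l.Coprime a) (c : ℤ) :
    quadGaussSum l ((c * a : ℤ) : ZMod l) * quadGaussSum a ((c * l : ℤ) : ZMod a) =
      quadGaussSum (l * a) (c : ZMod (l * a)) := by
  rw [quadGaussSum, quadGaussSum, quadGaussSum, Fintype.sum_mul_sum, ← Fintype.sum_prod_type']
  refine Fintype.sum_bijective _ (bijective_crt_combination h) _ _ ?_
  rintro ⟨r, s⟩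
  have e1 : ((c * a : ℤ) : ZMod l) * r ^ 2 = ((c * a * (r.val : ℤ) ^ 2 : ℤ) : ZMod l) := by
    push_cast; rw [ZMod.natCast_zmod_val]
  have e2 : ((c * l : ℤ) : ZMod a) * s ^ 2 = ((c * l * (s.val : ℤ) ^ 2 : ℤ) : ZMod a) := by
    push_cast; rw [ZMod.natCast_zmod_val]
  have e3 : (c : ZMod (l * a)) * ((a * (r.val : ℤ) + l * (s.val : ℤ) : ℤ) : ZMod (l * a)) ^ 2 =
      ((a * (c * a * (r.val : ℤ) ^ 2) : ℤ) : ZMod (l * a)) +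
        ((l * (c * l * (s.val : ℤ) ^ 2) : ℤ) : ZMod (l * a)) := by
    have h0 : (l : ZMod (l * a)) * (a : ZMod (l * a)) = 0 := by
      exact_mod_cast ZMod.natCast_self (l * a)
    push_cast
    linear_combination (2 * (c : ZMod (l * a)) * (r.val : ZMod (l * a)) * (s.val : ZMod (l * a))) * h0
  simp only [e1, e2, e3, AddChar.map_add_eq_mul]
  rw [stdAddChar_natCast_mul]
  congr 1
  have : NeZero (a * l) := ⟨by rw [mul_comm]; exact NeZero.ne _⟩
  have hl : (l : ℂ) ≠ 0 := by exact_mod_cast NeZero.ne l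
  have ha : (a : ℂ) ≠ 0 := by exact_mod_cast NeZero.ne a
  rw [ZMod.stdAddChar_coe, ZMod.stdAddChar_coe]
  congr 1
  push_cast
  field_simp

/-- Completing the square. -/
theorem sum_stdAddChar_quadratic {l : ℕ} [NeZero l] {b h h' : ZMod l} (hb : 2 * b = 1)
    (hh : h * h' = -1) (N : ZMod l) :
    ∑ r : ZMod l, (ZMod.stdAddChar (b * (h * r ^ 2 + N * r)) : ℂ) =
      quadGaussSum l (2 * h) * ZMod.stdAddChar (b ^ 3 * h' * N ^ 2) := by
  rw [quadGaussSum, Finset.sum_mul]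
  refine Fintype.sum_bijective (fun r : ZMod l => b * (r - b * h' * N)) ?_ _ _ ?_
  · refine Function.bijective_iff_has_inverse.mpr
      ⟨fun x => 2 * x + b * h' * N, fun r => ?_, fun x => ?_⟩
    · linear_combination (r - b * h' * N) * hb
    · linear_combination x * hb
  · intro r
    rw [← AddChar.map_add_eq_mul]
    congr 1
    linear_combination (2 * b ^ 3 * r * N * 2 - 2 * b ^ 4 * h' * N ^ 2) * hh
      - (b * h * r ^ 2 + 2 * b ^ 2 * r * N - b ^ 3 * h' * N ^ 2 + b * N * r) * hb

/-! ### The theta constants as values of the Jacobi theta function. -/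

theorem theta2_term_eq (τ : ℂ) (n : ℤ) :
    Complex.exp (Real.pi * Complex.I * ((n : ℂ) - 1 / 2) ^ 2 * τ) =
      Complex.exp (Real.pi * Complex.I * τ / 4) * jacobiTheta₂_term n (-τ / 2) τ := by
  rw [jacobiTheta₂_term, ← Complex.exp_add]
  congr 1
  ring

theorem theta3_term_eq (τ : ℂ) (n : ℤ) :
    Complex.exp (Real.pi * Complex.I * (n : ℂ) ^ 2 * τ) = jacobiTheta₂_term n 0 τ := by
  rw [jacobiTheta₂_term]
  congr 1
  ring

theorem theta3_eq_jacobiTheta (τ : ℂ) : theta3 τ = jacobiTheta τ := by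
  simp only [theta3, theta3_term_eq, jacobiTheta_eq_jacobiTheta₂, jacobiTheta₂]

/-- At `τ = i` every term is a positive real. This permits cancelling `θ₂(i)` in the Gauss sum
evaluation and in the uniqueness of the multiplier. -/
theorem theta2_I_ne_zero : theta2 Complex.I ≠ 0 := by
  have hs : Summable fun n : ℤ =>
      Complex.exp (Real.pi * Complex.I * ((n : ℂ) - 1 / 2) ^ 2 * Complex.I) := by
    simp only [theta2_term_eq]
    exact ((summable_jacobiTheta₂_term_iff _ _).mpr (by simp)).mul_left _
  have he : ∀ n : ℤ, Complex.exp (Real.pi * Complex.I * ((n : ℂ) - 1 / 2) ^ 2 * Complex.I) =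
      ((Real.exp (-Real.pi * ((n : ℝ) - 1 / 2) ^ 2) : ℝ) : ℂ) := by
    intro n
    push_cast
    congr 1
    linear_combination (Real.pi * ((n : ℂ) - 1 / 2) ^ 2) * Complex.I_mul_I
  simp only [he] at hs
  rw [theta2]
  simp only [he]
  rw [← Complex.ofReal_tsum]
  have hr := Complex.summable_ofReal.mp hs
  exact_mod_cast (hr.tsum_pos (fun n => (Real.exp_pos _).le) 0 (Real.exp_pos _)).ne'

theorem cexp_pi_I_int_eq {a b : ℤ} (h : Even (a - b)) :
    Complex.exp (Real.pi * Complex.I * a) = Complex.exp (Real.pi * Complex.I * b) := by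
  obtain ⟨k, hk⟩ := h
  rw [Complex.exp_eq_exp_iff_exists_int]
  refine ⟨k, ?_⟩
  have : (a : ℂ) = b + (k + k) := by
    rw [← Int.cast_add, ← Int.cast_add, ← hk]; congr 1; ring
  rw [this]; ring

/-! ### `θ₃` near a cusp `h / l` with `h` and `l` odd. -/

/-- Splitting the theta series at a cusp into residue classes. -/
theorem theta3_add_eq_sum {l : ℕ} [NeZero l] (hl : Odd l) {h : ℤ} (hh : Odd h) {z : ℂ}
    (hz : 0 < z.im) :
    theta3 (h / l + z) = ∑ r : Fin l,
      Complex.exp (Real.pi * Complex.I * (h * (r : ℕ) ^ 2 / l + (r : ℕ) ^ 2 * z)) *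
        jacobiTheta₂ (1 / 2 + (r : ℕ) * l * z) (l ^ 2 * z) := by
  have hl0 : (l : ℂ) ≠ 0 := by exact_mod_cast NeZero.ne l
  have hs : Summable fun n : ℤ =>
      Complex.exp (Real.pi * Complex.I * (n : ℂ) ^ 2 * (h / l + z)) := by
    simp only [theta3_term_eq]
    refine (summable_jacobiTheta₂_term_iff _ _).mpr ?_
    have : ((h : ℂ) / l).im = 0 := by
      rw [← Complex.ofReal_intCast, ← Complex.ofReal_natCast, ← Complex.ofReal_div,
        Complex.ofReal_im]
    rw [Complex.add_im, this, zero_add]; exact hz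
  rw [theta3, ← ((Int.divModEquiv l).trans (Equiv.prodComm _ _)).symm.tsum_eq]
  have hs' := (((Int.divModEquiv l).trans (Equiv.prodComm _ _)).symm.summable_iff).mpr hs
  simp only [Function.comp_def] at hs'
  rw [hs'.tsum_prod, tsum_fintype]
  refine Finset.sum_congr rfl fun r _ => ?_
  rw [jacobiTheta₂, ← tsum_mul_left]
  refine tsum_congr fun m => ?_
  have e : ((Int.divModEquiv l).trans (Equiv.prodComm _ _)).symm (r, m) = m * l + (r : ℕ) := rfl
  rw [e, jacobiTheta₂_term, ← Complex.exp_add]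
  -- As `h` and `l` are odd, the integer is congruent to `m` mod 2. The resulting sign `(-1)^m` is
  -- the `1 / 2` in the elliptic variable.
  have key : Complex.exp (Real.pi * Complex.I * (h * (2 * (r : ℕ) * m + l * m ^ 2) : ℤ)) =
      Complex.exp (Real.pi * Complex.I * m) := by
    apply cexp_pi_I_int_eq
    obtain ⟨u, rfl⟩ := hh
    obtain ⟨k, rfl⟩ := hl
    obtain ⟨j, hj⟩ := Int.even_mul_succ_self (m - 1)
    refine ⟨u * (2 * (r : ℕ) * m + (2 * k + 1) * m ^ 2) + (r : ℕ) * m + k * m ^ 2 + j, ?_⟩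
    push_cast
    linear_combination hj
  have lhs : Real.pi * Complex.I * ((m * l + (r : ℕ) : ℤ) : ℂ) ^ 2 * (h / l + z) =
      (Real.pi * Complex.I * (h * (2 * (r : ℕ) * m + l * m ^ 2) : ℤ)) +
      (Real.pi * Complex.I * (h * (r : ℕ) ^ 2 / l + (m * l + (r : ℕ)) ^ 2 * z)) := by
    push_cast
    field_simp
    ring
  rw [lhs, Complex.exp_add, key, ← Complex.exp_add]
  congr 1
  ring

/-- `(l + 1) / 2` inverts 2 mod `l`, so multiplying an even `X` by it gives the class of the integer
`X / 2`. This translates between `πi / l` exponents and characters mod `l`. -/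
theorem stdAddChar_half_mul {l : ℕ} [NeZero l] (hl : Odd l) {X : ℤ} (hX : Even X) :
    (ZMod.stdAddChar (((((l + 1) / 2 : ℕ) : ℤ) * X : ℤ) : ZMod l) : ℂ) =
      Complex.exp (Real.pi * Complex.I * X / l) := by
  have hl0 : (l : ℂ) ≠ 0 := by exact_mod_cast NeZero.ne l
  obtain ⟨k, hk⟩ := hl
  obtain ⟨Y, hY⟩ := hX
  have hB : (l + 1) / 2 = k + 1 := by omega
  have h2 : (((((l + 1) / 2 : ℕ) : ℤ) * X : ℤ) : ZMod l) = (Y : ZMod l) := by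
    have hk0 : (2 * k + 1 : ZMod l) = 0 := by
      have := ZMod.natCast_self l
      rw [hk] at this ⊢
      exact_mod_cast this
    rw [hB, hY]; push_cast
    linear_combination (Y : ZMod l) * hk0
  rw [h2, ZMod.stdAddChar_coe, hY]
  congr 1
  push_cast
  field_simp
  ring

theorem sum_fin_eq_sum_zmod {l : ℕ} [NeZero l] (f : ZMod l → ℂ) :
    ∑ r : Fin l, f ((r : ℕ) : ZMod l) = ∑ x : ZMod l, f x := by
  refine Fintype.sum_bijective (fun r : Fin l => ((r : ℕ) : ZMod l)) ?_ _ _ fun _ => rfl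
  rw [Fintype.bijective_iff_injective_and_card]
  refine ⟨fun r s hrs => ?_, by simp [ZMod.card]⟩
  have := congrArg ZMod.val hrs
  simp only [ZMod.val_natCast_of_lt r.2, ZMod.val_natCast_of_lt s.2] at this
  exact Fin.ext this

/-- The quadratic sum with a half-integral linear term, in terms of the Gauss sum. -/
theorem sum_cexp_quadratic {l : ℕ} [NeZero l] (hl : Odd l) {h h' : ℤ} (hh : Odd h)
    (hd : (l : ℤ) ∣ h * h' + 1) (n : ℤ) :
    ∑ r : Fin l, Complex.exp (Real.pi * Complex.I *
        (h * (r : ℕ) ^ 2 / l + 2 * (n - 1 / 2) * (r : ℕ) / l)) =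
      quadGaussSum l ((2 * h : ℤ) : ZMod l) *
        Complex.exp (Real.pi * Complex.I * h' * ((l + 1) ^ 3 - 1) / (4 * l)) *
        Complex.exp (Real.pi * Complex.I * (n - 1 / 2) ^ 2 * (h' / l)) := by
  have hl0 : (l : ℂ) ≠ 0 := by exact_mod_cast NeZero.ne l
  have hterm : ∀ r : Fin l, Complex.exp (Real.pi * Complex.I *
        (h * (r : ℕ) ^ 2 / l + 2 * (n - 1 / 2) * (r : ℕ) / l)) =
      ZMod.stdAddChar (((((l + 1) / 2 : ℕ) : ℤ) : ZMod l) *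
        ((h : ZMod l) * ((r : ℕ) : ZMod l) ^ 2 + ((2 * n - 1 : ℤ) : ZMod l) * ((r : ℕ) : ZMod l))) := by
    intro r
    have := stdAddChar_half_mul hl (X := h * ((r : ℕ) : ℤ) ^ 2 + (2 * n - 1) * ((r : ℕ) : ℤ)) (by
      obtain ⟨u, rfl⟩ := hh
      obtain ⟨j, hj⟩ := Int.even_mul_succ_self (((r : ℕ) : ℤ) - 1)
      exact ⟨u * (r : ℕ) ^ 2 + (n - 1) * (r : ℕ) + (j + (r : ℕ)), by linear_combination hj⟩)
    push_cast at this ⊢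
    rw [this]
    congr 1
    field_simp
  simp only [hterm]
  obtain ⟨k, hk⟩ := id hl
  have hB : (l + 1) / 2 = k + 1 := by omega
  have hk0 : (2 * k + 1 : ZMod l) = 0 := by
    have := ZMod.natCast_self l
    rw [hk] at this ⊢
    exact_mod_cast this
  have hb : 2 * ((((l + 1) / 2 : ℕ) : ℤ) : ZMod l) = 1 := by
    rw [hB]; push_cast; linear_combination hk0
  have hhz : (h : ZMod l) * (h' : ZMod l) = -1 := by
    have := (ZMod.intCast_zmod_eq_zero_iff_dvd _ l).mpr hd
    push_cast at this
    linear_combination this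
  rw [sum_fin_eq_sum_zmod (fun x => ZMod.stdAddChar (((((l + 1) / 2 : ℕ) : ℤ) : ZMod l) *
        ((h : ZMod l) * x ^ 2 + ((2 * n - 1 : ℤ) : ZMod l) * x))),
    sum_stdAddChar_quadratic hb hhz, mul_assoc (quadGaussSum l _)]
  congr 1
  · push_cast; rfl
  · have : ((((l + 1) / 2 : ℕ) : ℤ) : ZMod l) ^ 3 * (h' : ZMod l) * ((2 * n - 1 : ℤ) : ZMod l) ^ 2 =
        (((((l + 1) / 2 : ℕ) : ℤ) ^ 3 * h' * (2 * n - 1) ^ 2 : ℤ) : ZMod l) := by push_cast; rfl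
    rw [this, ZMod.stdAddChar_coe, ← Complex.exp_add, Complex.exp_eq_exp_iff_exists_int, hB]
    obtain ⟨j, hj⟩ := Int.even_mul_succ_self (n - 1)
    have hj' : (n : ℂ) ^ 2 - n = 2 * j := by
      have : n ^ 2 - n = 2 * j := by linear_combination hj
      exact_mod_cast this
    -- The exponents differ by `πi h' ((l + 1)³ - 1)((2n - 1)² - 1) / (4l)`. Here `(2n - 1)² - 1 =
    -- 8j` and `((l + 1)³ - 1) / l = l² + 3l + 3`.
    refine ⟨h' * j * ((2 * k + 1) ^ 2 + 3 * (2 * k + 1) + 3), ?_⟩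
    have hlk : (l : ℂ) = 2 * k + 1 := by exact_mod_cast hk
    rw [hlk] at hl0 ⊢
    push_cast
    field_simp
    linear_combination (h' * (112 + 384 * k + 384 * k ^ 2 + 128 * k ^ 3) : ℂ) * hj'

/-- Under the inversion formula, the `1 / 2` in the elliptic variable completes `n²` to `(n -
1/2)²`, giving the exponents of `θ₂`. -/
theorem jacobiTheta₂_at_cusp {l : ℕ} [NeZero l] (r : ℂ) {z : ℂ} (hz : z ≠ 0) :
    jacobiTheta₂ (1 / 2 + r * l * z) (l ^ 2 * z) =
      1 / (-Complex.I * (l ^ 2 * z)) ^ (1 / 2 : ℂ) *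
        (Complex.exp (-(Real.pi * Complex.I * r ^ 2 * z)) *
        ∑' n : ℤ, Complex.exp (Real.pi * Complex.I * (n - 1 / 2) ^ 2 * (-1 / (l ^ 2 * z))) *
          Complex.exp (Real.pi * Complex.I * (2 * (n - 1 / 2) * r / l))) := by
  have hl0 : (l : ℂ) ≠ 0 := by exact_mod_cast NeZero.ne l
  rw [jacobiTheta₂_functional_equation, mul_assoc]
  congr 1
  rw [jacobiTheta₂, ← tsum_mul_left, ← tsum_mul_left]
  refine tsum_congr fun n => ?_
  rw [jacobiTheta₂_term, ← Complex.exp_add, ← Complex.exp_add, ← Complex.exp_add]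
  congr 1
  field_simp
  ring

/-- The transformation of `θ₃` at the cusp `h / l` with `h` and `l` odd. -/
theorem theta3_at_cusp {l : ℕ} [NeZero l] (hl : Odd l) {h h' : ℤ} (hh : Odd h)
    (hd : (l : ℤ) ∣ h * h' + 1) {z : ℂ} (hz : 0 < z.im) :
    theta3 (h / l + z) = 1 / (-Complex.I * (l ^ 2 * z)) ^ (1 / 2 : ℂ) *
      (quadGaussSum l ((2 * h : ℤ) : ZMod l) *
        Complex.exp (Real.pi * Complex.I * h' * ((l + 1) ^ 3 - 1) / (4 * l))) *
      theta2 (h' / l - 1 / (l ^ 2 * z)) := by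
  have hl0 : (l : ℂ) ≠ 0 := by exact_mod_cast NeZero.ne l
  have hz0 : z ≠ 0 := by rintro rfl; simp at hz
  have hT : 0 < (-1 / ((l : ℂ) ^ 2 * z)).im := by
    have : (-1 / ((l : ℂ) ^ 2 * z)) = ((1 / (l : ℝ) ^ 2 : ℝ) : ℂ) * (-z)⁻¹ := by
      push_cast; field_simp
    rw [this, Complex.im_ofReal_mul]
    have hl1 : (0 : ℝ) < l := by exact_mod_cast Nat.pos_of_ne_zero (NeZero.ne l)
    refine mul_pos (by positivity) ?_
    rw [Complex.inv_im, Complex.neg_im, neg_neg]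
    exact div_pos hz (Complex.normSq_pos.mpr (neg_ne_zero.mpr hz0))
  rw [theta3_add_eq_sum hl hh hz]
  simp only [jacobiTheta₂_at_cusp _ hz0]
  -- The factors `e^{±πi r² z}` cancel, leaving `r` only in phases independent of `z`.
  have step : ∀ r : Fin l,
      Complex.exp (Real.pi * Complex.I * (h * (r : ℕ) ^ 2 / l + (r : ℕ) ^ 2 * z)) *
        (1 / (-Complex.I * (l ^ 2 * z)) ^ (1 / 2 : ℂ) *
        (Complex.exp (-(Real.pi * Complex.I * (r : ℕ) ^ 2 * z)) *
        ∑' n : ℤ, Complex.exp (Real.pi * Complex.I * (n - 1 / 2) ^ 2 * (-1 / (l ^ 2 * z))) *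
          Complex.exp (Real.pi * Complex.I * (2 * (n - 1 / 2) * (r : ℕ) / l)))) =
      1 / (-Complex.I * (l ^ 2 * z)) ^ (1 / 2 : ℂ) *
        ∑' n : ℤ, Complex.exp (Real.pi * Complex.I * (n - 1 / 2) ^ 2 * (-1 / (l ^ 2 * z))) *
          Complex.exp (Real.pi * Complex.I *
            (h * (r : ℕ) ^ 2 / l + 2 * (n - 1 / 2) * (r : ℕ) / l)) := by
    intro r
    rw [mul_left_comm, ← mul_assoc (Complex.exp _) (Complex.exp _), ← Complex.exp_add,
      ← tsum_mul_left]
    congr 2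
    funext n
    rw [mul_left_comm, ← Complex.exp_add]
    congr 2
    ring
  simp only [step]
  rw [← Finset.mul_sum, mul_assoc]
  congr 1
  rw [← Summable.tsum_finsetSum]
  · simp only [← Finset.mul_sum, sum_cexp_quadratic hl hh hd]
    rw [theta2, ← tsum_mul_left]
    refine tsum_congr fun n => ?_
    rw [mul_left_comm, ← Complex.exp_add]
    congr 2
    ring
  · intro r _
    have hs := ((summable_jacobiTheta₂_term_iff (-(-1 / ((l : ℂ) ^ 2 * z)) / 2 + (r : ℕ) / l)
      (-1 / ((l : ℂ) ^ 2 * z))).mpr hT).mul_left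
      (Complex.exp (Real.pi * Complex.I * (-1 / ((l : ℂ) ^ 2 * z) / 4 +
        (h * (r : ℕ) ^ 2 / l - (r : ℕ) / l))))
    refine hs.congr fun n => ?_
    rw [jacobiTheta₂_term, ← Complex.exp_add, ← Complex.exp_add]
    congr 1
    ring

/-! ### Principal square roots and the value of the Gauss sum. -/

/-- The hypothesis says `arg w ≤ π / 2`, so adding `π / 2` to the argument does not cross the branch
cut. -/
theorem I_mul_cpow_half {w : ℂ} (hw : w ≠ 0) (h : 0 ≤ w.re ∨ w.im < 0) :
    (Complex.I * w) ^ (1 / 2 : ℂ) = Complex.exp (Real.pi * Complex.I / 4) * w ^ (1 / 2 : ℂ) := by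
  have harg : Complex.log (Complex.I * w) = Complex.log Complex.I + Complex.log w := by
    rw [Complex.log_mul_eq_add_log_iff Complex.I_ne_zero hw, Complex.arg_I]
    have h1 := Complex.arg_le_pi_div_two_iff.mpr h
    have h2 := Complex.neg_pi_lt_arg w
    constructor <;> linarith [Real.pi_pos]
  rw [Complex.cpow_def_of_ne_zero (mul_ne_zero Complex.I_ne_zero hw),
    Complex.cpow_def_of_ne_zero hw, harg, ← Complex.exp_add, Complex.log_I]
  congr 1
  ring

theorem ofReal_mul_cpow_half {r : ℝ} (hr : 0 < r) {w : ℂ} (hw : w ≠ 0) :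
    (r * w) ^ (1 / 2 : ℂ) = (Real.sqrt r : ℂ) * w ^ (1 / 2 : ℂ) := by
  have hr' : (r : ℂ) ≠ 0 := by exact_mod_cast hr.ne'
  rw [Complex.cpow_def_of_ne_zero (mul_ne_zero hr' hw), Complex.cpow_def_of_ne_zero hw,
    Complex.log_ofReal_mul hr hw, add_mul, Complex.exp_add, Real.sqrt_eq_rpow,
    Complex.ofReal_cpow hr.le, Complex.cpow_def_of_ne_zero hr', Complex.ofReal_log hr.le]
  norm_num

theorem theta3_S {w : ℂ} :
    theta3 w = 1 / (-Complex.I * w) ^ (1 / 2 : ℂ) * theta3 (-1 / w) := by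
  rw [theta3_eq_jacobiTheta, theta3_eq_jacobiTheta, jacobiTheta_eq_jacobiTheta₂,
    jacobiTheta_eq_jacobiTheta₂, jacobiTheta₂_functional_equation]
  simp

theorem theta3_intCast_add_I {n : ℤ} (hn : Odd n) : theta3 (n + Complex.I) = theta2 Complex.I := by
  have h := theta3_at_cusp (l := 1) (by decide) (h := n) (h' := 0) hn (by simp) (z := Complex.I)
    (by simp)
  rw [quadGaussSum_one] at h
  simpa using h

/-- With `W = 1 / (1 + l i)`, evaluate `θ₃(iW)` twice. The cusp formula at `1 / l` leads to `θ₂(i)`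
with the Gauss sum as a factor; inversion leads to `θ₃(-l + i) = θ₂(i)`. Cancelling `θ₂(i)` isolates
the Gauss sum. -/
theorem quadGaussSum_two {l : ℕ} [NeZero l] (hl : Odd l) :
    quadGaussSum l 2 = (Real.sqrt l : ℂ) *
      Complex.exp (Real.pi * Complex.I * ((l ^ 2 + 3 * l + 4 : ℕ) / 4)) := by
  have hl0 : (l : ℂ) ≠ 0 := by exact_mod_cast NeZero.ne l
  have hlr : (0 : ℝ) < l := by exact_mod_cast Nat.pos_of_ne_zero (NeZero.ne l)
  have hV : (1 + l * Complex.I : ℂ) ≠ 0 := by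
    intro h
    simpa using congrArg Complex.re h
  set W : ℂ := 1 / (1 + l * Complex.I) with hW
  have hW0 : W ≠ 0 := one_div_ne_zero hV
  have hWre : 0 ≤ W.re := by
    rw [hW, one_div, Complex.inv_re]
    exact div_nonneg (by simp) (Complex.normSq_nonneg _)
  have hWim : W.im = -(l / Complex.normSq (1 + l * Complex.I)) := by
    rw [hW, one_div, Complex.inv_im]; simp [neg_div]
  have hz : 0 < (-(W / l)).im := by
    have : -(W / l) = ((-(1 / l) : ℝ) : ℂ) * W := by push_cast; field_simp
    rw [this, Complex.im_ofReal_mul, hWim]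
    have := Complex.normSq_pos.mpr hV
    rw [neg_mul_neg]
    positivity
  have h1 := theta3_at_cusp hl (h := 1) (h' := -1) odd_one (by simp) hz
  have e1 : ((1 : ℤ) : ℂ) / l + -(W / l) = Complex.I * W := by
    rw [hW]; push_cast; field_simp; ring
  have e2 : ((-1 : ℤ) : ℂ) / l - 1 / (l ^ 2 * -(W / l)) = Complex.I := by
    rw [hW]; push_cast; field_simp; ring
  have e3 : -Complex.I * (l ^ 2 * -(W / l)) = Complex.I * ((l : ℝ) * W) := by
    push_cast; field_simp
  have e4 : -1 / (Complex.I * W) = ((-l : ℤ) : ℂ) + Complex.I := by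
    rw [hW]; push_cast; field_simp
    linear_combination -Complex.I_sq
  have e5 : -Complex.I * (Complex.I * W) = W := by
    linear_combination (-W) * Complex.I_mul_I
  have hodd : Odd (-l : ℤ) := by exact_mod_cast (Int.odd_coe_nat l |>.mpr hl).neg
  rw [e1, e2, e3, theta3_S, e4, e5, theta3_intCast_add_I hodd] at h1
  have h2 := mul_right_cancel₀ theta2_I_ne_zero h1
  have hlW : ((l : ℝ) : ℂ) * W ≠ 0 := mul_ne_zero (by exact_mod_cast hl0) hW0
  rw [I_mul_cpow_half hlW (Or.inl (by rw [Complex.re_ofReal_mul]; positivity)),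
    ofReal_mul_cpow_half hlr hW0] at h2
  have hWc : W ^ (1 / 2 : ℂ) ≠ 0 := by simp [Complex.cpow_eq_zero_iff, hW0]
  have hsq : (Real.sqrt l : ℂ) ≠ 0 := by exact_mod_cast (Real.sqrt_pos.mpr hlr).ne'
  have he := Complex.exp_ne_zero (Real.pi * Complex.I / 4)
  have e6 : Complex.exp (Real.pi * Complex.I * ((l ^ 2 + 3 * l + 4 : ℕ) / 4)) *
      Complex.exp (Real.pi * Complex.I * (-1 : ℤ) * ((l + 1) ^ 3 - 1) / (4 * l)) =
      Complex.exp (Real.pi * Complex.I / 4) := by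
    rw [← Complex.exp_add]
    congr 1
    push_cast
    field_simp
    ring
  have e7 := Complex.exp_ne_zero (Real.pi * Complex.I * (-1 : ℤ) * ((l + 1) ^ 3 - 1) / (4 * l))
  have e8 : (((2 * 1 : ℤ)) : ZMod l) = 2 := by push_cast; ring
  rw [e8] at h2
  generalize Complex.exp (Real.pi * Complex.I * (-1 : ℤ) * ((l + 1) ^ 3 - 1) / (4 * l)) = E
    at h2 e6 e7
  apply mul_right_cancel₀ e7
  rw [mul_assoc, e6]
  field_simp at h2
  linear_combination -h2

/-- The sign `ε_l` in the evaluation of the quadratic Gauss sum. -/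
noncomputable def gaussEps (l : ℕ) : ℂ := if l % 4 = 1 then 1 else Complex.I

theorem gaussEps_ne_zero (l : ℕ) : gaussEps l ≠ 0 := by
  unfold gaussEps; split_ifs <;> simp

/-- For odd `l` the number `l² + 3l + 4` is even, so the left side is a power of `i`, and both sides
depend only on `l` mod 8. -/
theorem cexp_pi_I_eq_jacobiSym_two {l : ℕ} (hl : Odd l) :
    Complex.exp (Real.pi * Complex.I * ((l ^ 2 + 3 * l + 4 : ℕ) / 4)) =
      jacobiSym 2 l * gaussEps l := by
  have hE : ∀ n : ℕ, Complex.exp (Real.pi * Complex.I * ((n : ℂ) / 2)) = Complex.I ^ n := by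
    intro n
    have h := Complex.exp_nat_mul (Real.pi / 2 * Complex.I) n
    rw [Complex.exp_pi_div_two_mul_I] at h
    rw [← h]
    congr 1
    ring
  rw [jacobiSym.at_two hl, ZMod.χ₈_nat_eq_if_mod_eight, gaussEps]
  obtain ⟨n, hn⟩ : ∃ n, l ^ 2 + 3 * l + 4 = 2 * n := by
    obtain ⟨k, rfl⟩ := hl
    exact ⟨2 * k ^ 2 + 5 * k + 4, by ring⟩
  have : (((l ^ 2 + 3 * l + 4 : ℕ) : ℂ) / 4) = (n : ℂ) / 2 := by
    rw [hn]; push_cast; ring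
  rw [this, hE, Complex.I_pow_eq_pow_mod]
  have hl8 : l % 8 = 1 ∨ l % 8 = 3 ∨ l % 8 = 5 ∨ l % 8 = 7 := by
    have := Nat.odd_iff.mp hl; omega
  have hl' := (Nat.div_add_mod l 8).symm
  generalize l / 8 = t at hl'
  rcases hl8 with h | h | h | h <;> rw [h] at hl' <;> subst hl' <;> ring_nf at hn
  · have h1 : n % 4 = 0 := by omega
    simp [h1, Nat.add_mod, Nat.mul_mod]
  · have h1 : n % 4 = 3 := by omega
    have h2 : (8 * t + 3) % 4 = 3 := by omega
    simp [h1, h2, Nat.add_mod, Nat.mul_mod]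
  · have h1 : n % 4 = 2 := by omega
    have h2 : (8 * t + 5) % 4 = 1 := by omega
    simp [h1, h2, Nat.add_mod, Nat.mul_mod]
  · have h1 : n % 4 = 1 := by omega
    have h2 : (8 * t + 7) % 4 = 3 := by omega
    simp [h1, h2, Nat.add_mod, Nat.mul_mod]

/-- Quadratic reciprocity: `ε` fails to be multiplicative exactly when both arguments are 3 mod 4.
-/
theorem gaussEps_mul {a l : ℕ} (ha : Odd a) (hl : Odd l) (h : l.Coprime a) :
    gaussEps (l * a) = gaussEps l * gaussEps a * (jacobiSym a l * jacobiSym l a) := by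
  have h1 : (jacobiSym l a : ℂ) * jacobiSym l a = 1 := by
    have := jacobiSym.sq_one (a := (l : ℤ)) (b := a) (by simpa using h)
    rw [sq] at this; exact_mod_cast this
  rw [jacobiSym.quadratic_reciprocity ha hl]
  have h2 : ((((-1) ^ (a / 2 * (l / 2)) * jacobiSym l a : ℤ)) : ℂ) * jacobiSym l a =
      (-1) ^ (a / 2 * (l / 2)) := by
    push_cast; rw [mul_assoc, h1, mul_one]
  rw [h2, gaussEps, gaussEps, gaussEps, Nat.mul_mod]
  have ha4 : a % 4 = 1 ∨ a % 4 = 3 := by have := Nat.odd_iff.mp ha; omega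
  have hl4 : l % 4 = 1 ∨ l % 4 = 3 := by have := Nat.odd_iff.mp hl; omega
  rcases ha4 with h3 | h3 <;> rcases hl4 with h4 | h4
  · have h5 : Even (a / 2) := Nat.even_iff.mpr (by omega)
    simp [h3, h4, (h5.mul_right _).neg_one_pow]
  · have h5 : Even (a / 2) := Nat.even_iff.mpr (by omega)
    simp [h3, h4, (h5.mul_right _).neg_one_pow]
  · have h5 : Even (l / 2) := Nat.even_iff.mpr (by omega)
    simp [h3, h4, (h5.mul_left _).neg_one_pow]
  · have h5 : Odd (a / 2) := Nat.odd_iff.mpr (by omega)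
    have h6 : Odd (l / 2) := Nat.odd_iff.mpr (by omega)
    simp [h3, h4, (h5.mul h6).neg_one_pow]

theorem conj_gaussEps {l : ℕ} (hl : Odd l) :
    (starRingEnd ℂ) (gaussEps l) = jacobiSym (-1) l * gaussEps l := by
  have h2 := Nat.odd_iff.mp hl
  rw [jacobiSym.at_neg_one hl, ZMod.χ₄_nat_eq_if_mod_four, gaussEps]
  rcases (by omega : l % 4 = 1 ∨ l % 4 = 3) with h | h <;> simp [h, h2]

/-- The quadratic Gauss sum to an odd modulus. -/
theorem quadGaussSum_eval (l : ℕ) [NeZero l] (hl : Odd l) (a : ℤ) (ha : IsCoprime a l) :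
    quadGaussSum l ((2 * a : ℤ) : ZMod l) =
      jacobiSym (2 * a) l * gaussEps l * Real.sqrt l := by
  suffices H : ∀ (l : ℕ) [NeZero l], Odd l → ∀ a : ℤ, IsCoprime a l →
      quadGaussSum l ((2 * a : ℤ) : ZMod l) = jacobiSym (2 * a) l * gaussEps l * Real.sqrt l from
    H l hl a ha
  clear ha a hl
  intro l
  induction l using Nat.strong_induction_on with
  | _ l ih =>
  intro _ hl a ha
  -- In `G(l; 2c) G(c; 2l) = G(lc; 2)` the right side is known and the second factor is covered by
  -- induction, since `c < l`.
  have pos : ∀ c : ℕ, Odd c → c < l → l.Coprime c →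
      quadGaussSum l ((2 * c : ℤ) : ZMod l) = jacobiSym (2 * c) l * gaussEps l * Real.sqrt l := by
    intro c hc hcl hco
    have : NeZero c := ⟨hc.pos.ne'⟩
    have : NeZero (l * c) := ⟨mul_ne_zero (NeZero.ne l) (NeZero.ne c)⟩
    have h1 := quadGaussSum_mul_quadGaussSum hco 2
    rw [ih c hcl hc l (Nat.isCoprime_iff_coprime.mpr hco), Int.cast_ofNat,
      quadGaussSum_two (hl.mul hc), cexp_pi_I_eq_jacobiSym_two (hl.mul hc),
      gaussEps_mul hc hl hco, jacobiSym.mul_right, jacobiSym.mul_left, Nat.cast_mul,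
      Real.sqrt_mul (by positivity)] at h1
    rw [jacobiSym.mul_left]
    have h2 : (jacobiSym 2 c : ℂ) ≠ 0 := by
      have : Int.gcd 2 c = 1 := hc.coprime_two_left
      exact_mod_cast jacobiSym.ne_zero this
    have h3 : (jacobiSym l c : ℂ) ≠ 0 := by
      exact_mod_cast jacobiSym.ne_zero (a := (l : ℤ)) (b := c) (by simpa using hco)
    have h4 := gaussEps_ne_zero c
    have h5 : (Real.sqrt c : ℂ) ≠ 0 := by
      have : (0 : ℝ) < c := by exact_mod_cast hc.pos
      exact_mod_cast (Real.sqrt_pos.mpr this).ne'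
    apply mul_right_cancel₀ (mul_ne_zero (mul_ne_zero (mul_ne_zero h2 h3) h4) h5)
    push_cast at h1 ⊢
    linear_combination h1
  have hlpos : (0 : ℤ) < l := by exact_mod_cast hl.pos
  rcases Nat.lt_or_ge 1 l with h1 | h1
  · obtain ⟨c, hc⟩ := Int.eq_ofNat_of_zero_le (Int.emod_nonneg a hlpos.ne')
    have hcl : c < l := by have := Int.emod_lt_of_pos a hlpos; omega
    have hac : a = c + l * (a / l) := by rw [← hc]; exact (Int.emod_add_mul_ediv a l).symm
    have hcz : (a : ZMod l) = c := by
      rw [hac]; push_cast; simp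
    have hco : l.Coprime c := by
      rw [hac] at ha
      exact (Nat.isCoprime_iff_coprime.mp (IsCoprime.of_add_mul_left_left ha)).symm
    have hj : jacobiSym (2 * a) l = jacobiSym (2 * c) l := by
      apply jacobiSym.mod_left'
      rw [hac, show 2 * (c + (l : ℤ) * (a / l)) = 2 * c + l * (2 * (a / l)) by ring,
        Int.add_mul_emod_self_left]
    have hg : ((2 * a : ℤ) : ZMod l) = ((2 * c : ℤ) : ZMod l) := by push_cast; rw [hcz]
    rw [hj, hg]
    -- For even `c` pass to the odd number `l - c ≡ -c`; negation conjugates the Gauss sum, which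
    -- costs the factor `(-1 / l)`.
    rcases Nat.even_or_odd c with hev | hodd
    · have hd : Odd (l - c) := Nat.Odd.sub_even hcl.le hl hev
      have hc0 : c ≠ 0 := by
        rintro rfl
        rw [Nat.coprime_zero_right] at hco; omega
      have h2 := pos (l - c) hd (by omega) ((Nat.coprime_self_sub_right hcl.le).mpr hco)
      have e1 : ((2 * (c : ℤ) : ℤ) : ZMod l) = -((2 * ((l - c : ℕ) : ℤ) : ℤ) : ZMod l) := by
        push_cast [Nat.cast_sub hcl.le]; simp
      have e2 : jacobiSym (2 * c) l = jacobiSym (-1 * (2 * ((l - c : ℕ) : ℤ))) l := by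
        apply jacobiSym.mod_left'
        push_cast [Nat.cast_sub hcl.le]
        rw [show (-1 * (2 * ((l : ℤ) - c))) = 2 * c + l * (-2) by ring, Int.add_mul_emod_self_left]
      rw [e1, e2, quadGaussSum_neg, h2, map_mul, map_mul, conj_gaussEps hl, Complex.conj_ofReal,
        map_intCast, jacobiSym.mul_left (-1)]
      push_cast
      ring
    · exact pos c hodd hcl hco
  · obtain rfl : l = 1 := by have := hl.pos; omega
    rw [quadGaussSum_one]
    simp [gaussEps]

/-! ### Existence, uniqueness and value of the `θ₃`-multiplier. -/

theorem coe_SL2_smul (γ : SL(2, ℤ)) (τ : ℍ) :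
    ((γ • τ : ℍ) : ℂ) =
      (((γ 0 0 : ℤ) : ℂ) * τ + ((γ 0 1 : ℤ) : ℂ)) / (((γ 1 0 : ℤ) : ℂ) * τ + ((γ 1 1 : ℤ) : ℂ)) := by
  rw [UpperHalfPlane.specialLinearGroup_apply]
  simp

theorem SL2_det_eq (γ : SL(2, ℤ)) : γ 0 0 * γ 1 1 - γ 0 1 * γ 1 0 = 1 := by
  rw [← Matrix.det_fin_two, γ.det_coe]

theorem SL2_denom_ne_zero (γ : SL(2, ℤ)) (τ : ℍ) :
    ((γ 1 0 : ℤ) : ℂ) * τ + ((γ 1 1 : ℤ) : ℂ) ≠ 0 := by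
  intro h
  have him := congrArg Complex.im h
  have hre := congrArg Complex.re h
  simp only [Complex.add_im, ← Complex.ofReal_intCast, Complex.im_ofReal_mul,
    Complex.ofReal_im, Complex.zero_im, add_zero, UpperHalfPlane.coe_im, mul_eq_zero, τ.im_ne_zero, or_false] at him
  have hc : γ 1 0 = 0 := by exact_mod_cast him
  rw [hc] at hre
  have hd : γ 1 1 = 0 := by
    have : ((γ 1 1 : ℤ) : ℝ) = 0 := by simpa using hre
    exact_mod_cast this
  have := SL2_det_eq γ
  rw [hc, hd] at this
  simp at this

theorem IsTheta3Multiplier.unique {γ : SL(2, ℤ)} {κ κ' : ℂ} (h : IsTheta3Multiplier γ κ)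
    (h' : IsTheta3Multiplier γ κ') : κ = κ' := by
  have e := (h UpperHalfPlane.I).symm.trans (h' UpperHalfPlane.I)
  have e1 := mul_right_cancel₀ (by simpa using theta2_I_ne_zero) e
  refine mul_right_cancel₀ (mul_ne_zero (Complex.exp_ne_zero _) ?_) e1
  rw [Ne, Complex.cpow_eq_zero_iff, not_and_or]
  exact Or.inl (SL2_denom_ne_zero γ _)

theorem IsTheta3Multiplier.theta3Multiplier_eq {γ : SL(2, ℤ)} {κ : ℂ}
    (h : IsTheta3Multiplier γ κ) : theta3Multiplier γ = κ := by
  have H : ∃ κ : ℂ, IsTheta3Multiplier γ κ := ⟨κ, h⟩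
  rw [theta3Multiplier, dif_pos H]
  exact H.choose_spec.unique h

theorem cexp_pi_I_div_four_mul_self :
    Complex.exp (Real.pi * Complex.I / 4) * Complex.exp (Real.pi * Complex.I / 4) = Complex.I := by
  rw [← Complex.exp_add]
  convert Complex.exp_pi_div_two_mul_I using 2
  ring

/-- With `W = cτ + d` and `c = -l`, one has `γτ = -a / l + 1 / (l W)`. The cusp formula applies with
`h = -a`, `h' = d` (as `ad ≡ 1` mod `l`), and its `θ₂` argument is exactly `τ`. Here `W` lies in the
lower half plane, which settles the branch of the root. -/
theorem isTheta3Multiplier_of_neg {γ : SL(2, ℤ)} {l : ℕ} (hl : Odd l) (ha : Odd (γ 0 0 : ℤ))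
    (hc : γ 1 0 = -(l : ℤ)) :
    IsTheta3Multiplier γ (Complex.I * (jacobiSym (2 * -γ 0 0) l * gaussEps l) *
      Complex.exp (Real.pi * Complex.I * (γ 1 1 : ℤ) * ((l + 1) ^ 3 - 1) / (4 * l))) := by
  intro τ
  have : NeZero l := ⟨hl.pos.ne'⟩
  have hl0 : (l : ℂ) ≠ 0 := by exact_mod_cast NeZero.ne l
  have hlr : (0 : ℝ) < l := by exact_mod_cast hl.pos
  have hsq : (Real.sqrt l : ℂ) ≠ 0 := by exact_mod_cast (Real.sqrt_pos.mpr hlr).ne'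
  have hdet := SL2_det_eq γ
  have hW0 := SL2_denom_ne_zero γ τ
  rw [coe_SL2_smul]
  rw [hc] at hdet hW0 ⊢
  set a : ℤ := γ 0 0
  set b : ℤ := γ 0 1
  set d : ℤ := γ 1 1
  set W : ℂ := ((-(l : ℤ) : ℤ) : ℂ) * τ + d with hW
  have hWim : W.im < 0 := by
    have : W.im = -(l * τ.im) := by
      rw [hW]; simp
    rw [this, neg_lt_zero]
    exact mul_pos hlr τ.im_pos
  have hz : 0 < (1 / (l * W)).im := by
    have e : 1 / ((l : ℂ) * W) = ((1 / l : ℝ) : ℂ) * W⁻¹ := by push_cast; field_simp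
    rw [e, Complex.im_ofReal_mul, Complex.inv_im]
    have := Complex.normSq_pos.mpr hW0
    have h2 : 0 < -W.im := neg_pos.mpr hWim
    positivity
  have hd : (l : ℤ) ∣ -a * d + 1 := ⟨b, by linear_combination -hdet⟩
  have key := theta3_at_cusp hl ha.neg hd hz
  have hcop : IsCoprime (-a) (l : ℤ) := ⟨-d, b, by linear_combination hdet⟩
  have hdetC : (a : ℂ) * d - b * (-(l : ℤ) : ℤ) = 1 := by exact_mod_cast hdet
  have e1 : ((-a : ℤ) : ℂ) / l + 1 / (l * W) = (a * τ + b) / W := by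
    push_cast at hW hdetC ⊢
    field_simp
    rw [hW]
    linear_combination -hdetC
  have e2 : (d : ℂ) / l - 1 / (l ^ 2 * (1 / (l * W))) = τ := by
    field_simp
    rw [hW]
    push_cast
    ring
  have hIW : Complex.I * W ≠ 0 := mul_ne_zero Complex.I_ne_zero hW0
  have e3 : -Complex.I * (l ^ 2 * (1 / (l * W))) = (l : ℝ) * (Complex.I * W)⁻¹ := by
    push_cast
    field_simp
    linear_combination -Complex.I_sq
  -- `iW` has positive real part, so inversion commutes with the principal root.
  have harg : (Complex.I * W).arg ≠ Real.pi := by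
    intro h
    have := (Complex.arg_eq_pi_iff.mp h).1
    simp at this
    linarith
  rw [e1, e2, e3, ofReal_mul_cpow_half hlr (inv_ne_zero hIW), Complex.inv_cpow _ _ harg,
    I_mul_cpow_half hW0 (Or.inr hWim), quadGaussSum_eval l hl _ hcop] at key
  rw [key]
  have hWc : W ^ (1 / 2 : ℂ) ≠ 0 := by simp [Complex.cpow_eq_zero_iff, hW0]
  have hI : Complex.exp (Real.pi * Complex.I / 4) =
      Complex.I * Complex.exp (-(Real.pi * Complex.I / 4)) := by
    rw [Complex.exp_neg, ← div_eq_mul_inv, eq_div_iff (Complex.exp_ne_zero _),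
      cexp_pi_I_div_four_mul_self]
  rw [hI]
  have hE := Complex.exp_ne_zero (-(Real.pi * Complex.I / 4))
  field_simp

/-- For `c > 0` replace `γ` by `-γ`, which acts identically. Since `W = cτ + d` is then in the upper
half plane, `W^{1/2} = i (-W)^{1/2}`, and the multiplier changes by `-i`. -/
theorem existsUnique_theta3Multiplier {γ : SL(2, ℤ)} (ha : Odd (γ 0 0 : ℤ))
    (hc : Odd (γ 1 0 : ℤ)) : ∃! κ : ℂ, IsTheta3Multiplier γ κ := by
  suffices ∃ κ : ℂ, IsTheta3Multiplier γ κ from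
    this.elim fun κ hκ => ⟨κ, hκ, fun _ h => h.unique hκ⟩
  obtain ⟨l, hl | hl⟩ := Int.eq_nat_or_neg (γ 1 0)
  · have hlo : Odd l := by rw [hl] at hc; exact_mod_cast hc
    have hn := isTheta3Multiplier_of_neg (γ := -γ) hlo (by simpa using ha) (by simp [hl])
    generalize Complex.I * (jacobiSym (2 * -(-γ) 0 0) l * gaussEps l) *
      Complex.exp (Real.pi * Complex.I * ((-γ) 1 1 : ℤ) * ((l + 1) ^ 3 - 1) / (4 * l)) = κ at hn
    refine ⟨-Complex.I * κ, fun τ => ?_⟩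
    have h := hn τ
    rw [ModularGroup.SL_neg_smul] at h
    rw [h]
    have hW0 := SL2_denom_ne_zero γ τ
    have hneg : (((-γ) 1 0 : ℤ) : ℂ) * (τ : ℂ) + (((-γ) 1 1 : ℤ) : ℂ) =
        -(((γ 1 0 : ℤ) : ℂ) * (τ : ℂ) + ((γ 1 1 : ℤ) : ℂ)) := by
      simp; ring
    have him : 0 < (((γ 1 0 : ℤ) : ℂ) * (τ : ℂ) + ((γ 1 1 : ℤ) : ℂ)).im := by
      rw [hl]
      simpa using mul_pos (Nat.cast_pos.mpr hlo.pos) τ.im_pos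
    rw [hneg]
    generalize ((γ 1 0 : ℤ) : ℂ) * (τ : ℂ) + ((γ 1 1 : ℤ) : ℂ) = W at hW0 him
    have h1 : W = Complex.I * (Complex.I * -W) := by
      linear_combination W * Complex.I_mul_I
    have h2 : W ^ (1 / 2 : ℂ) = Complex.I * (-W) ^ (1 / 2 : ℂ) := by
      conv_lhs => rw [h1]
      rw [I_mul_cpow_half (mul_ne_zero Complex.I_ne_zero (neg_ne_zero.mpr hW0))
        (Or.inl (by simpa using him.le)),
        I_mul_cpow_half (neg_ne_zero.mpr hW0) (Or.inr (by simpa using him)), ← mul_assoc,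
        cexp_pi_I_div_four_mul_self]
    rw [h2]
    linear_combination (κ * Complex.exp (-(Real.pi * Complex.I / 4)) * (-W) ^ (1 / 2 : ℂ) *
      theta2 τ) * Complex.I_mul_I
  · have hlo : Odd l := by rw [hl] at hc; simpa using hc
    exact ⟨_, isTheta3Multiplier_of_neg hlo ha hl⟩

theorem theta3Multiplier_cuspMatrix_inv {l : ℕ} (hl : Odd l) {h h' : ℤ} (hh : Odd h)
    (H : (l : ℤ) ∣ h * h' + 1) :
    theta3Multiplier (cuspMatrix l h h' H)⁻¹ =
      Complex.I * (jacobiSym (2 * h) l * gaussEps l) *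
        Complex.exp (Real.pi * Complex.I * h' * ((l + 1) ^ 3 - 1) / (4 * l)) := by
  have h00 : (cuspMatrix l h h' H)⁻¹ 0 0 = -h := by
    rw [Matrix.SpecialLinearGroup.SL2_inv_expl]; rfl
  have h10 : (cuspMatrix l h h' H)⁻¹ 1 0 = -(l : ℤ) := by
    rw [Matrix.SpecialLinearGroup.SL2_inv_expl]; rfl
  have h11 : (cuspMatrix l h h' H)⁻¹ 1 1 = h' := by
    rw [Matrix.SpecialLinearGroup.SL2_inv_expl]; rfl
  have key := isTheta3Multiplier_of_neg hl (γ := (cuspMatrix l h h' H)⁻¹)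
    (by rw [h00]; exact hh.neg) h10
  rw [key.theta3Multiplier_eq, h00, h11, neg_neg]

/-! ### From the multiplier sum to the Salié sum. -/

theorem I_pow_eq_gaussEps {l : ℕ} (hl : Odd l) :
    Complex.I ^ ((l + 3) * (l - 1) / 4) = jacobiSym (-1) l * gaussEps l := by
  rw [← conj_gaussEps hl, gaussEps, Complex.I_pow_eq_pow_mod]
  have h2 := Nat.odd_iff.mp hl
  have hl' := (Nat.div_add_mod l 4).symm
  generalize l / 4 = t at hl'
  rcases (by omega : l % 4 = 1 ∨ l % 4 = 3) with h | h <;> rw [h] at hl'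
  · have e : (l + 3) * (l - 1) / 4 = 4 * (t * (t + 1)) := by
      rw [hl', show (4 * t + 1 + 3) * (4 * t + 1 - 1) = 4 * (4 * (t * (t + 1))) by
        rw [Nat.add_sub_cancel]; ring]
      omega
    simp [e, h]
  · have e : (l + 3) * (l - 1) / 4 = 4 * (t ^ 2 + 2 * t) + 3 := by
      rw [hl', show (4 * t + 3 + 3) * (4 * t + 3 - 1) = 4 * (4 * (t ^ 2 + 2 * t) + 3) by
        rw [show 4 * t + 3 - 1 = 4 * t + 2 by omega]; ring]
      omega
    have e' : (4 * (t ^ 2 + 2 * t) + 3) % 4 = 3 := by omega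
    simp [e, e', h]

/-- From `H ≡ -B h` follow `h ≡ -2H`, hence `(2h / l) = (-1 / l)(H / l)`, and `H⁻¹ ≡ 2h'`. The rest
compares roots of unity, using `8B³ ≡ 1` mod `l`. -/
theorem arithmeticFactor_term_eq {l : ℕ} [NeZero l] (hl : Odd l) {h : ℕ} {h' : ℤ} (hh : Odd h)
    (hd : ((2 * l : ℕ) : ℤ) ∣ h * h' + 1) (hdl : (l : ℤ) ∣ h * h' + 1) (m : ℤ) (H : ℕ)
    (hH : (H : ZMod l) = -((((l + 1) / 2 : ℕ) : ZMod l) * h)) :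
    -Complex.I * (theta3Multiplier (cuspMatrix l h h' hdl)⁻¹ *
        Complex.exp (-(2 * Real.pi * Complex.I *
          ((4 * (m : ℂ) * (h : ℂ) + 3 * (h' : ℂ)) / (4 * ((2 * l : ℕ) : ℂ)))))) =
      Complex.I ^ ((l + 3) * (l - 1) / 4) * (-1 : ℂ) ^ (m - 1) * ((jacobiSym (H : ℤ) l : ℂ) *
      Complex.exp (2 * Real.pi * Complex.I / (l : ℂ) *
        ((m : ℂ) * (H : ℂ) + ((-3 * (((l + 1) / 2 : ℕ) : ℤ) ^ 4 : ℤ) : ℂ) *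
          ((((H : ZMod l)⁻¹).val : ℕ) : ℂ)))) := by
  have hBn : 2 * ((l + 1) / 2) = l + 1 := by have := Nat.odd_iff.mp hl; omega
  have hψ : ∀ X : ℤ, Even X → (ZMod.stdAddChar (((((l + 1) / 2 : ℕ) : ℤ) * X : ℤ) : ZMod l) : ℂ) =
      Complex.exp (Real.pi * Complex.I * X / l) := fun X hX => stdAddChar_half_mul hl hX
  generalize (l + 1) / 2 = B at hH hBn hψ ⊢
  have hl0 : (l : ℂ) ≠ 0 := by exact_mod_cast NeZero.ne l
  have hhz : Odd (h : ℤ) := by exact_mod_cast hh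
  have hb : 2 * (B : ZMod l) = 1 := by
    have h2 : ((2 * B : ℕ) : ZMod l) = ((l + 1 : ℕ) : ZMod l) := by rw [hBn]
    push_cast at h2
    simpa using h2
  have hbC : (B : ℂ) = (l + 1) / 2 := by
    have h2 : ((2 * B : ℕ) : ℂ) = ((l + 1 : ℕ) : ℂ) := by rw [hBn]
    push_cast at h2
    linear_combination h2 / 2
  have hhm : (h : ZMod l) * (h' : ZMod l) = -1 := by
    have := (ZMod.intCast_zmod_eq_zero_iff_dvd _ l).mpr hdl
    push_cast at this
    linear_combination this
  have hinv : (H : ZMod l)⁻¹ = 2 * h' := by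
    apply ZMod.inv_eq_of_mul_eq_one
    rw [hH]
    linear_combination (-2 * (B : ZMod l)) * hhm + hb
  have hodd' : Odd h' := by
    obtain ⟨k, hk⟩ := hd
    have h1 : Odd ((h : ℤ) * h') := ⟨l * k - 1, by push_cast at hk; linear_combination hk⟩
    exact (Int.odd_mul.mp h1).2
  have hJ : (jacobiSym (2 * h) l : ℂ) = jacobiSym (-1) l * jacobiSym H l := by
    rw [← Int.cast_mul, ← jacobiSym.mul_left]
    have h4 : jacobiSym (-1 * H) l = jacobiSym 4 l * jacobiSym (-1 * H) l := by
      rw [jacobiSym.at_four hl, one_mul]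
    rw [h4, ← jacobiSym.mul_left]
    congr 1
    apply jacobiSym.mod_left'
    apply (ZMod.intCast_eq_intCast_iff _ _ l).mp
    push_cast
    rw [hH]
    linear_combination (-2 * (h : ZMod l)) * hb
  have hsign : (-1 : ℂ) ^ (m - 1) = Complex.exp (Real.pi * Complex.I * (m - 1 : ℤ)) := by
    rw [mul_comm, Complex.exp_int_mul, Complex.exp_pi_mul_I]
  -- Here `h' (2B³ - 1)` collects the multiplier exponent and `-3h' / 4`. The term `l (m - 1)` is
  -- invisible mod `l`; it makes the total even and accounts for the sign `(-1)^{m-1}`.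
  have hX : Even (h' * (2 * (B : ℤ) ^ 3 - 1) - m * h - l * (m - 1)) := by
    obtain ⟨u, hu⟩ := hodd'
    obtain ⟨v, hv⟩ := hhz
    obtain ⟨w, hw⟩ := hl
    rw [hu, hv]
    subst hw
    refine ⟨u * (2 * B ^ 3 - 1) + B ^ 3 - m * v - w * (m - 1) - m, ?_⟩
    push_cast
    ring
  have hexp : Complex.exp (2 * Real.pi * Complex.I / (l : ℂ) *
        ((m : ℂ) * (H : ℂ) + ((-3 * (B : ℤ) ^ 4 : ℤ) : ℂ) *
          ((((H : ZMod l)⁻¹).val : ℕ) : ℂ))) =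
      Complex.exp (Real.pi * Complex.I *
        (h' * (2 * (B : ℤ) ^ 3 - 1) - m * h - l * (m - 1) : ℤ) / l) := by
    rw [← hψ _ hX]
    have h1 := ZMod.stdAddChar_coe (N := l) (m * H + (-3 * (B : ℤ) ^ 4) *
      (((H : ZMod l)⁻¹).val : ℤ))
    have h2 : 2 * Real.pi * Complex.I / (l : ℂ) *
        ((m : ℂ) * (H : ℂ) + ((-3 * (B : ℤ) ^ 4 : ℤ) : ℂ) *
          ((((H : ZMod l)⁻¹).val : ℕ) : ℂ)) = 2 * Real.pi * Complex.I *
          ((m * H + (-3 * (B : ℤ) ^ 4) * (((H : ZMod l)⁻¹).val : ℤ) : ℤ) : ℂ) / l := by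
      push_cast; ring
    rw [h2, ← h1]
    congr 1
    push_cast
    rw [ZMod.natCast_zmod_val, hinv, hH, ZMod.natCast_self]
    linear_combination (-(4 * B ^ 3 + 2 * B ^ 2 + B) * h') * hb
  rw [theta3Multiplier_cuspMatrix_inv hl hhz hdl, hexp, hJ, I_pow_eq_gaussEps hl, hsign]
  have hfin : Complex.exp (Real.pi * Complex.I * h' * ((l + 1) ^ 3 - 1) / (4 * l)) *
      Complex.exp (-(2 * Real.pi * Complex.I *
          ((4 * (m : ℂ) * (h : ℂ) + 3 * (h' : ℂ)) / (4 * ((2 * l : ℕ) : ℂ))))) =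
      Complex.exp (Real.pi * Complex.I * (m - 1 : ℤ)) *
      Complex.exp (Real.pi * Complex.I *
        (h' * (2 * (B : ℤ) ^ 3 - 1) - m * h - l * (m - 1) : ℤ) / l) := by
    rw [← Complex.exp_add, ← Complex.exp_add]
    congr 1
    push_cast
    rw [hbC]
    field_simp
    ring
  push_cast at hfin ⊢
  linear_combination (-Complex.I * Complex.I * jacobiSym (-1) l * jacobiSym H l * gaussEps l) * hfin
    - (jacobiSym (-1) l * jacobiSym H l * gaussEps l *
      (Complex.exp (Real.pi * Complex.I * (m - 1)) *
      Complex.exp (Real.pi * Complex.I *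
        (h' * (2 * (B : ℂ) ^ 3 - 1) - m * h - l * (m - 1)) / l))) * Complex.I_mul_I

theorem arithmeticFactor_eq_salieSum {l : ℕ} (hl : Odd l) (h' : ℕ → ℤ)
    (hh' : IsNegInverseChoice (2 * l) h') (m : ℤ) :
    arithmeticFactor l h' hh' m = Complex.I ^ ((l + 3) * (l - 1) / 4) * (-1 : ℂ) ^ (m - 1) *
      salieSum m (-3 * (((l + 1) / 2 : ℕ) : ℤ) ^ 4) l := by
  have : NeZero l := ⟨hl.pos.ne'⟩
  rw [arithmeticFactor, salieSum, Finset.mul_sum, Finset.mul_sum]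
  have hb : 2 * (((l + 1) / 2 : ℕ) : ZMod l) = 1 := by
    have h1 : 2 * ((l + 1) / 2) = l + 1 := by have := Nat.odd_iff.mp hl; omega
    have h2 : ((2 * ((l + 1) / 2) : ℕ) : ZMod l) = ((l + 1 : ℕ) : ZMod l) := by rw [h1]
    push_cast at h2
    simpa using h2
  have hmem : ∀ {h : ℕ}, h ∈ (Finset.range (2 * l)).filter (fun h => h.Coprime (2 * l)) ↔
      h < 2 * l ∧ Odd h ∧ h.Coprime l := by
    intro h
    rw [Finset.mem_filter, Finset.mem_range, Nat.coprime_mul_iff_right, Nat.coprime_two_right]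
  refine Finset.sum_bij
    (fun h _ => (-((((l + 1) / 2 : ℕ) : ZMod l) * ((h : ℕ) : ZMod l))).val) ?_ ?_ ?_ ?_
  · rintro ⟨h, hh⟩ -
    rw [Finset.mem_filter, Finset.mem_range]
    refine ⟨ZMod.val_lt _, ?_⟩
    rw [← ZMod.isUnit_iff_coprime, ZMod.natCast_zmod_val]
    exact ((IsUnit.of_mul_eq_one _ (by rw [mul_comm]; exact hb)).mul
      ((ZMod.isUnit_iff_coprime h l).mpr (hmem.mp hh).2.2)).neg
  · rintro ⟨h, hh⟩ - ⟨g, hg⟩ - heq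
    have h1 : (h : ZMod l) = (g : ZMod l) := by
      have := ZMod.val_injective l heq
      linear_combination (-2) * this + ((g : ZMod l) - h) * hb
    rw [ZMod.natCast_eq_natCast_iff] at h1
    obtain ⟨hlt, ho, -⟩ := hmem.mp hh
    obtain ⟨glt, go, -⟩ := hmem.mp hg
    have h2 : h ≡ g [MOD 2] := by rw [Nat.ModEq, Nat.odd_iff.mp ho, Nat.odd_iff.mp go]
    have h3 : h ≡ g [MOD 2 * l] :=
      (Nat.modEq_and_modEq_iff_modEq_mul (Nat.coprime_two_left.mpr hl)).mp ⟨h2, h1⟩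
    exact Subtype.ext (Nat.ModEq.eq_of_lt_of_lt h3 hlt glt)
  · intro H hH
    obtain ⟨Hlt, Hc⟩ := Finset.mem_filter.mp hH
    rw [Finset.mem_range] at Hlt
    have hu : IsUnit (-(2 * (H : ZMod l))) :=
      ((IsUnit.of_mul_eq_one _ hb).mul ((ZMod.isUnit_iff_coprime H l).mpr Hc)).neg
    -- As `l` is odd, exactly one of the two lifts `v`, `v + l` of a residue to `[0, 2l)` is odd.
    obtain ⟨h, hlt, ho, hc⟩ : ∃ h : ℕ, h < 2 * l ∧ Odd h ∧ (h : ZMod l) = -(2 * (H : ZMod l)) := by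
      have hv := ZMod.val_lt (-(2 * (H : ZMod l)))
      rcases Nat.even_or_odd (-(2 * (H : ZMod l))).val with he | ho
      · exact ⟨(-(2 * (H : ZMod l))).val + l, by omega, he.add_odd hl, by
          push_cast; rw [ZMod.natCast_zmod_val, ZMod.natCast_self, add_zero]⟩
      · exact ⟨_, by omega, ho, ZMod.natCast_zmod_val _⟩
    refine ⟨⟨h, hmem.mpr ⟨hlt, ho, ?_⟩⟩, Finset.mem_attach _ _, ?_⟩
    · rw [← ZMod.isUnit_iff_coprime, hc]; exact hu
    · have : -((((l + 1) / 2 : ℕ) : ZMod l) * (h : ZMod l)) = (H : ZMod l) := by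
        rw [hc]; linear_combination (H : ZMod l) * hb
      simp only [this]
      exact ZMod.val_natCast_of_lt Hlt
  · rintro ⟨h, hh⟩ -
    exact arithmeticFactor_term_eq hl (hmem.mp hh).2.1 (hh' h (Finset.mem_filter.mp hh).2) _ m _
      (ZMod.natCast_zmod_val _)

theorem mainTheorem6 :
    (∀ γ : SL(2, ℤ), Odd (γ 0 0 : ℤ) → Odd (γ 1 0 : ℤ) →
      ∃! κ : ℂ, IsTheta3Multiplier γ κ) ∧
    ∀ (l : ℕ), Odd l →
      ∀ (h' : ℕ → ℤ) (hh' : IsNegInverseChoice (2 * l) h') (m : ℤ),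
        arithmeticFactor l h' hh' m =
          Complex.I ^ ((l + 3) * (l - 1) / 4) * (-1 : ℂ) ^ (m - 1) *
            salieSum m (-3 * (((l + 1) / 2 : ℕ) : ℤ) ^ 4) l :=
  ⟨fun _ ha hc => existsUnique_theta3Multiplier ha hc,
    fun _ hl h' hh' m => arithmeticFactor_eq_salieSum hl h' hh' m⟩
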